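/- Let $(K,\mathcal T)$ be a compact Hausdorff space and let $d$ be a metric on $K$ such that property $P(d,\mathcal T)$ holds: the topology $\mathcal T_d$ induced by $d$ is finer than (or equal to) $\mathcal T$, and there is a sequence $(B_n)_{n\in\mathbb N}$ of subsets of $K$ such that the topology generated by $\mathcal T\cup\{B_n : n\in\mathbb N\}$ is finer than (or equal to) $\mathcal T_d$. Let $C(K)$ be the space of real-valued $\mathcal T$-continuous functions on $K$. Then there is a norm $\|\cdot\|$ on $C(K)$, equivalent to the supremum norm, which is locally uniformly rotund at every $f\in C(K)$ that is $d$-uniformly continuous; that is, for each such $f$ and every sequence $(f_r)$ in $C(K)$, $$\tfrac12\|f\|^2+\tfrac12\|f_r\|^2-\bigl\|\tfrac12(f+f_r)\bigr\|^2\to 0\quad\text{implies}\quad \|f-f_r\|\to 0 .$$ -/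

import Mathlib

open Filter Topology

/-- `d` is a metric on the set `X`. It is kept as a plain function, because `X` also carries a
topology that need not be the one induced by `d`. -/
structure IsMetric {X : Type*} (d : X → X → ℝ) : Prop where
  nonneg : ∀ x y, 0 ≤ d x y
  eq_zero_iff : ∀ x y, d x y = 0 ↔ x = y
  symm : ∀ x y, d x y = d y x
  triangle : ∀ x y z, d x z ≤ d x y + d y z

/-- `U` is open for the topology induced by the metric `d`. -/
def MetricOpen {X : Type*} (d : X → X → ℝ) (U : Set X) : Prop :=
  ∀ x ∈ U, ∃ ε > 0, ∀ y, d x y < ε → y ∈ U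

/-- `f` is uniformly continuous for the metric `d`. -/
def MetricUniformContinuous {X : Type*} (d : X → X → ℝ) (f : X → ℝ) : Prop :=
  ∀ ε > 0, ∃ δ > 0, ∀ x y, d x y < δ → |f x - f y| < ε

/-- Property `P(d, 𝒯)`, where `𝒯` is the given topology of `X`: the topology of the metric `d` is
finer than `𝒯`, and for some sequence `(B n)` of subsets of `X` the topology generated by
`𝒯 ∪ {B n : n}` is finer than the topology of `d`. -/
structure PropertyP (X : Type*) [TopologicalSpace X] (d : X → X → ℝ) : Prop where
  isMetric : IsMetric d
  metricOpen_of_isOpen : ∀ U : Set X, IsOpen U → MetricOpen d U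
  exists_seq : ∃ B : ℕ → Set X, ∀ U : Set X, MetricOpen d U →
    IsOpen[TopologicalSpace.generateFrom ({V : Set X | IsOpen V} ∪ Set.range B)] U

/-- The seminorm `N` is a norm equivalent to the given norm of `E`
(the lower bound makes `N` definite). -/
def IsEquivalentNorm {E : Type*} [NormedAddCommGroup E] [NormedSpace ℝ E]
    (N : Seminorm ℝ E) : Prop :=
  ∃ c C : ℝ, 0 < c ∧ 0 < C ∧ ∀ x, c * ‖x‖ ≤ N x ∧ N x ≤ C * ‖x‖

/-- The norm `N` is locally uniformly rotund at `x`. -/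
def IsLURAt {E : Type*} [AddCommGroup E] [Module ℝ E] (N : Seminorm ℝ E) (x : E) : Prop :=
  ∀ u : ℕ → E,
    Tendsto (fun r => (1 / 2 : ℝ) * N x ^ 2 + (1 / 2 : ℝ) * N (u r) ^ 2
      - N ((1 / 2 : ℝ) • (x + u r)) ^ 2) atTop (𝓝 0) →
    Tendsto (fun r => N (x - u r)) atTop (𝓝 0)

/-! The squared norm is `‖g‖ ^ 2 + T g + T (-g)`, where `T` is a weighted sum of countably many
convex, positively 2-homogeneous functions. It suffices that for every `d`-uniformly continuous `f`
and every `e > 0` one summand has the property that a small defect at `f`, `g` forces `|f - g| ≤ e`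
on `K`.

On a closed set `L` where `f` oscillates little, the norm and the suprema of `g` and `-g` over `L`
do this (`Program.controls_leaf`). Otherwise `L` is cut in two (`Program.exists_split`). Property
`P` yields countably many isolated families of `d`-small sets covering `K`
(`PropertyP.exists_isolatedCover`). By compactness, finitely many isolated pieces carry the high
values of `f` of a suitable type, and finitely many others carry the low values. These two finite
families have disjoint closures, and each maximises a mean of suprema, with a gap, among families of
the same size. By the Deville-type lemma `IsSquareGauge.dominates_of_gap`, a supremum over all pairs
of families then controls the functions attached to the two parts of `L`. Only the sizes of the
families enter the recipe, so there are countably many recipes.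

The cutting must stop. Each part loses the points of the current type at one of finitely many levels
of `f`, whereas types stabilise along decreasing closed sets
(`IsolatedCover.eventually_inter_upper_type_nonempty`). -/

/-! ### Convex gauges and their midpoint defects. -/

/-- A convex, positively `2`-homogeneous function lying between `0` and the squared norm. -/
structure IsSquareGauge {E : Type*} [NormedAddCommGroup E] [NormedSpace ℝ E]
    (q : E → ℝ) : Prop where
  convexOn : ConvexOn ℝ Set.univ q
  smul : ∀ c : ℝ, 0 ≤ c → ∀ x, q (c • x) = c ^ 2 * q x
  nonneg : ∀ x, 0 ≤ q x
  le : ∀ x, q x ≤ ‖x‖ ^ 2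

/-- A convex, positively homogeneous function lying between `0` and the norm. -/
structure IsGauge {E : Type*} [NormedAddCommGroup E] [NormedSpace ℝ E]
    (p : E → ℝ) : Prop where
  convexOn : ConvexOn ℝ Set.univ p
  smul : ∀ c : ℝ, 0 ≤ c → ∀ x, p (c • x) = c * p x
  nonneg : ∀ x, 0 ≤ p x
  le : ∀ x, p x ≤ ‖x‖

/-- The midpoint convexity defect of `q` at `x, y`. -/
noncomputable def defect {E : Type*} [AddCommGroup E] [Module ℝ E] (q : E → ℝ) (x y : E) : ℝ :=
  (1 / 2) * q x + (1 / 2) * q y - q ((1 / 2 : ℝ) • (x + y))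

/-- The defect of `q` at `x` is small as soon as the defect of `p` at `x` is small. -/
def Dominates {E : Type*} [AddCommGroup E] [Module ℝ E] (x : E) (p q : E → ℝ) : Prop :=
  ∀ η > 0, ∃ δ > 0, ∀ y, defect p x y < δ → defect q x y < η

section Gauges

variable {E : Type*} [NormedAddCommGroup E] [NormedSpace ℝ E]

theorem ConvexOn.defect_nonneg {q : E → ℝ} (h : ConvexOn ℝ Set.univ q) (x y : E) :
    0 ≤ defect q x y := by
  have := h.2 (Set.mem_univ x) (Set.mem_univ y) (by norm_num : (0 : ℝ) ≤ 1 / 2)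
    (by norm_num : (0 : ℝ) ≤ 1 / 2) (by norm_num)
  simp only [smul_eq_mul, ← smul_add] at this
  unfold defect
  linarith

theorem defect_add (p q : E → ℝ) (x y : E) :
    defect (fun z => p z + q z) x y = defect p x y + defect q x y := by
  unfold defect; ring

theorem defect_const_mul (c : ℝ) (q : E → ℝ) (x y : E) :
    defect (fun z => c * q z) x y = c * defect q x y := by
  unfold defect; ring

theorem Dominates.trans {x : E} {p q r : E → ℝ} (h : Dominates x p q) (h' : Dominates x q r) :
    Dominates x p r := by
  intro η hη
  obtain ⟨δ, hδ, H⟩ := h' η hη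
  obtain ⟨δ', hδ', H'⟩ := h δ hδ
  exact ⟨δ', hδ', fun y hy => H y (H' y hy)⟩

theorem Dominates.of_mul_defect_le {x : E} {p q : E → ℝ} {c : ℝ} (hc : 0 < c)
    (h : ∀ y, c * defect q x y ≤ defect p x y) : Dominates x p q := by
  intro η hη
  refine ⟨c * η, by positivity, fun y hy => ?_⟩
  exact lt_of_mul_lt_mul_left ((h y).trans_lt hy) hc.le

theorem IsGauge.sq {p : E → ℝ} (h : IsGauge p) : IsSquareGauge fun x => p x ^ 2 where
  convexOn := h.convexOn.pow (fun x _ => h.nonneg x) 2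
  smul c hc x := by rw [h.smul c hc, mul_pow]
  nonneg x := sq_nonneg _
  le x := pow_le_pow_left₀ (h.nonneg x) (h.le x) 2

theorem IsGauge.norm : IsGauge fun x : E => ‖x‖ where
  convexOn := convexOn_univ_norm
  smul c hc x := by rw [norm_smul, Real.norm_of_nonneg hc]
  nonneg := norm_nonneg
  le _ := le_rfl

theorem IsGauge.comp_neg {p : E → ℝ} (h : IsGauge p) : IsGauge fun x => p (-x) where
  convexOn := by
    refine ⟨convex_univ, fun x _ y _ a b ha hb hab => ?_⟩
    have := h.convexOn.2 (Set.mem_univ (-x)) (Set.mem_univ (-y)) ha hb hab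
    simpa [add_comm] using this
  smul c hc x := by rw [← smul_neg, h.smul c hc]
  nonneg x := h.nonneg _
  le x := by simpa using h.le (-x)

theorem IsSquareGauge.comp_neg {q : E → ℝ} (h : IsSquareGauge q) :
    IsSquareGauge fun x => q (-x) where
  convexOn := by
    refine ⟨convex_univ, fun x _ y _ a b ha hb hab => ?_⟩
    have := h.convexOn.2 (Set.mem_univ (-x)) (Set.mem_univ (-y)) ha hb hab
    simpa [add_comm] using this
  smul c hc x := by rw [← smul_neg, h.smul c hc]
  nonneg x := h.nonneg _
  le x := by simpa using h.le (-x)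

theorem IsGauge.sum_div {ι : Type*} {p : ι → E → ℝ} (h : ∀ i, IsGauge (p i)) (s : Finset ι) {c : ℝ}
    (hc : s.card ≤ c) : IsGauge fun x => (∑ i ∈ s, p i x) / c where
  convexOn := by
    have hc0 : 0 ≤ c := (Nat.cast_nonneg _).trans hc
    refine ⟨convex_univ, fun x _ y _ a b ha hb hab => ?_⟩
    have : ∑ i ∈ s, p i (a • x + b • y) ≤ a * ∑ i ∈ s, p i x + b * ∑ i ∈ s, p i y := by
      rw [Finset.mul_sum, Finset.mul_sum, ← Finset.sum_add_distrib]
      refine Finset.sum_le_sum fun i _ => ?_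
      exact (h i).convexOn.2 (Set.mem_univ x) (Set.mem_univ y) ha hb hab
    calc _ ≤ (a * ∑ i ∈ s, p i x + b * ∑ i ∈ s, p i y) / c :=
          div_le_div_of_nonneg_right this hc0
      _ = _ := by simp only [smul_eq_mul]; ring
  smul c' hc' x := by
    simp only [fun i => (h i).smul c' hc', ← Finset.mul_sum]; ring
  nonneg x := div_nonneg (Finset.sum_nonneg fun i _ => (h i).nonneg x)
    ((Nat.cast_nonneg _).trans hc)
  le x := by
    have hc0 : 0 ≤ c := (Nat.cast_nonneg _).trans hc
    refine div_le_of_le_mul₀ hc0 (norm_nonneg x) ?_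
    calc ∑ i ∈ s, p i x ≤ s.card * ‖x‖ := by
          simpa using Finset.sum_le_card_nsmul s (fun i => p i x) ‖x‖ fun i _ => (h i).le x
      _ ≤ c * ‖x‖ := by gcongr
      _ = _ := mul_comm _ _

theorem IsGauge.iSup {ι : Type*} {p : ι → E → ℝ} (h : ∀ i, IsGauge (p i)) :
    IsGauge fun x => ⨆ i, p i x := by
  have bdd : ∀ x, BddAbove (Set.range fun i => p i x) := fun x =>
    ⟨‖x‖, by rintro _ ⟨i, rfl⟩; exact (h i).le x⟩
  have nn : ∀ x, 0 ≤ ⨆ i, p i x := fun x => Real.iSup_nonneg fun i => (h i).nonneg x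
  refine ⟨⟨convex_univ, fun x _ y _ a b ha hb hab => ?_⟩, fun c hc x => ?_, nn, fun x => ?_⟩
  · refine Real.iSup_le (fun i => ?_)
      (add_nonneg (smul_nonneg ha (nn x)) (smul_nonneg hb (nn y)))
    refine ((h i).convexOn.2 (Set.mem_univ x) (Set.mem_univ y) ha hb hab).trans ?_
    exact add_le_add (smul_le_smul_of_nonneg_left (le_ciSup (bdd x) i) ha)
      (smul_le_smul_of_nonneg_left (le_ciSup (bdd y) i) hb)
  · simp only [fun i => (h i).smul c hc x]
    exact (Real.mul_iSup_of_nonneg hc _).symm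
  · exact Real.iSup_le (fun i => (h i).le x) (norm_nonneg _)

theorem IsSquareGauge.iSup {ι : Type*} {q : ι → E → ℝ} (h : ∀ i, IsSquareGauge (q i)) :
    IsSquareGauge fun x => ⨆ i, q i x := by
  have bdd : ∀ x, BddAbove (Set.range fun i => q i x) := fun x =>
    ⟨‖x‖ ^ 2, by rintro _ ⟨i, rfl⟩; exact (h i).le x⟩
  have nn : ∀ x, 0 ≤ ⨆ i, q i x := fun x => Real.iSup_nonneg fun i => (h i).nonneg x
  refine ⟨⟨convex_univ, fun x _ y _ a b ha hb hab => ?_⟩, fun c hc x => ?_, nn, fun x => ?_⟩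
  · refine Real.iSup_le (fun i => ?_)
      (add_nonneg (smul_nonneg ha (nn x)) (smul_nonneg hb (nn y)))
    refine ((h i).convexOn.2 (Set.mem_univ x) (Set.mem_univ y) ha hb hab).trans ?_
    exact add_le_add (smul_le_smul_of_nonneg_left (le_ciSup (bdd x) i) ha)
      (smul_le_smul_of_nonneg_left (le_ciSup (bdd y) i) hb)
  · simp only [fun i => (h i).smul c hc x]
    exact (Real.mul_iSup_of_nonneg (sq_nonneg c) _).symm
  · exact Real.iSup_le (fun i => (h i).le x) (sq_nonneg _)

theorem IsSquareGauge.summable {ι : Type*} {q : ι → E → ℝ} (h : ∀ i, IsSquareGauge (q i))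
    {w : ι → ℝ} (hw : ∀ i, 0 ≤ w i) (hs : Summable w) (x : E) :
    Summable fun i => w i * q i x :=
  Summable.of_nonneg_of_le (fun i => mul_nonneg (hw i) ((h i).nonneg x))
    (fun i => mul_le_mul_of_nonneg_left ((h i).le x) (hw i)) (hs.mul_right _)

theorem IsSquareGauge.tsum {ι : Type*} {q : ι → E → ℝ} (h : ∀ i, IsSquareGauge (q i))
    {w : ι → ℝ} (hw : ∀ i, 0 ≤ w i) (hs : Summable w) (h1 : ∑' i, w i ≤ 1) :
    IsSquareGauge fun x => ∑' i, w i * q i x := by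
  have S := IsSquareGauge.summable h hw hs
  refine ⟨⟨convex_univ, fun x _ y _ a b ha hb hab => ?_⟩, fun c hc x => ?_,
    fun x => tsum_nonneg fun i => mul_nonneg (hw i) ((h i).nonneg x), fun x => ?_⟩
  · simp only [smul_eq_mul, ← tsum_mul_left]
    rw [← ((S x).mul_left a).tsum_add ((S y).mul_left b)]
    refine (S _).tsum_le_tsum (fun i => ?_) (((S x).mul_left a).add ((S y).mul_left b))
    have := (h i).convexOn.2 (Set.mem_univ x) (Set.mem_univ y) ha hb hab
    simp only [smul_eq_mul] at this
    nlinarith [hw i]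
  · rw [← tsum_mul_left]
    congr 1
    ext i
    rw [(h i).smul c hc]; ring
  · calc ∑' i, w i * q i x ≤ ∑' i, w i * ‖x‖ ^ 2 :=
          (S x).tsum_le_tsum (fun i => mul_le_mul_of_nonneg_left ((h i).le x) (hw i))
            (hs.mul_right _)
      _ = (∑' i, w i) * ‖x‖ ^ 2 := tsum_mul_right
      _ ≤ ‖x‖ ^ 2 := mul_le_of_le_one_left (sq_nonneg _) h1

theorem IsSquareGauge.combination {p q : E → ℝ} (hp : IsSquareGauge p) (hq : IsSquareGauge q)
    {a b : ℝ} (ha : 0 ≤ a) (hb : 0 ≤ b) (hab : a + b ≤ 1) :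
    IsSquareGauge fun x => a * p x + b * q x where
  convexOn := (hp.convexOn.smul ha).add (hq.convexOn.smul hb)
  smul c hc x := by rw [hp.smul c hc, hq.smul c hc]; ring
  nonneg x := add_nonneg (mul_nonneg ha (hp.nonneg x)) (mul_nonneg hb (hq.nonneg x))
  le x := by nlinarith [hp.le x, hq.le x, sq_nonneg ‖x‖, hp.nonneg x, hq.nonneg x]

theorem IsSquareGauge.const_mul {q : E → ℝ} (hq : IsSquareGauge q) {a : ℝ} (ha : 0 ≤ a)
    (ha1 : a ≤ 1) : IsSquareGauge fun x => a * q x := by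
  simpa using hq.combination hq ha le_rfl (by simpa using ha1)

theorem IsSquareGauge.dominates_half_add_half {p q : E → ℝ} (hp : IsSquareGauge p)
    (hq : IsSquareGauge q) (x : E) :
    Dominates x (fun z => 1 / 2 * p z + 1 / 2 * q z) p ∧
      Dominates x (fun z => 1 / 2 * p z + 1 / 2 * q z) q := by
  constructor <;> refine Dominates.of_mul_defect_le (c := 1 / 2) (by norm_num) fun y => ?_ <;>
    rw [defect_add, defect_const_mul, defect_const_mul]
  · exact le_add_of_nonneg_right (mul_nonneg (by norm_num) (hq.convexOn.defect_nonneg x y))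
  · exact le_add_of_nonneg_left (mul_nonneg (by norm_num) (hp.convexOn.defect_nonneg x y))

theorem IsSquareGauge.dominates_tsum {ι : Type*} {q : ι → E → ℝ} (h : ∀ i, IsSquareGauge (q i))
    {w : ι → ℝ} (hw : ∀ i, 0 < w i) (hs : Summable w) (x : E) (i : ι) :
    Dominates x (fun z => ∑' i, w i * q i z) (q i) := by
  refine Dominates.of_mul_defect_le (hw i) fun y => ?_
  have S := IsSquareGauge.summable h (fun i => (hw i).le) hs
  have S' := (((S x).mul_left (1 / 2)).add ((S y).mul_left (1 / 2))).sub
    (S ((1 / 2 : ℝ) • (x + y)))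
  have key : defect (fun z => ∑' i, w i * q i z) x y = ∑' i, w i * defect (q i) x y := by
    unfold defect
    rw [← tsum_mul_left, ← tsum_mul_left,
      ← ((S x).mul_left (1 / 2)).tsum_add ((S y).mul_left (1 / 2)),
      ← (((S x).mul_left (1 / 2)).add ((S y).mul_left (1 / 2))).tsum_sub (S _)]
    congr 1
    ext j
    ring
  rw [key]
  have S'' : Summable fun i => w i * defect (q i) x y := by
    refine S'.congr fun j => ?_
    unfold defect; ring
  exact S''.le_tsum i fun j _ => mul_nonneg (hw j).le ((h j).convexOn.defect_nonneg x y)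

/-- At the midpoint `p` is at most the average of `p x` and `p y`, and the average of two squares
exceeds the square of the average by `(p x - p y) ^ 2 / 4`. -/
theorem IsGauge.sq_sub_le_defect {p : E → ℝ} (h : IsGauge p) (x y : E) :
    (p x - p y) ^ 2 / 4 ≤ defect (fun z => p z ^ 2) x y := by
  have h1 := h.convexOn.2 (Set.mem_univ x) (Set.mem_univ y)
    (by norm_num : (0 : ℝ) ≤ 1 / 2) (by norm_num : (0 : ℝ) ≤ 1 / 2) (by norm_num)
  simp only [smul_eq_mul, ← smul_add] at h1
  have h2 := pow_le_pow_left₀ (h.nonneg _) h1 2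
  unfold defect
  nlinarith

/-- A form of Deville's lemma: a supremum whose dominant part singles out one index controls the
perturbing part at this index. -/
theorem IsSquareGauge.dominates_of_gap {ι : Type*} {φ ψ : ι → E → ℝ} {c κ : ℝ} {x : E} (i₀ : ι)
    (hc : 0 < c) (hφ : ∀ i, IsSquareGauge (φ i)) (hψ : ∀ i, IsSquareGauge (ψ i))
    (hκ : ∀ i ≠ i₀, φ i x ≤ φ i₀ x - κ) (hcκ : c * ‖x‖ ^ 2 < κ) :
    Dominates x (fun z => ⨆ i, (φ i z + c * ψ i z)) (ψ i₀) := by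
  have bdd : ∀ z, BddAbove (Set.range fun i => φ i z + c * ψ i z) := fun z =>
    ⟨‖z‖ ^ 2 + c * ‖z‖ ^ 2, by
      rintro _ ⟨i, rfl⟩
      exact add_le_add ((hφ i).le z) (mul_le_mul_of_nonneg_left ((hψ i).le z) hc.le)⟩
  intro η hη
  refine ⟨min ((κ - c * ‖x‖ ^ 2) / 4) (c * η / 2), lt_min (by linarith) (by positivity),
    fun y hy => ?_⟩
  set δ := min ((κ - c * ‖x‖ ^ 2) / 4) (c * η / 2) with hδ
  have hδ0 : 0 < δ := lt_min (by linarith) (by positivity)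
  have hδ1 : δ ≤ (κ - c * ‖x‖ ^ 2) / 4 := min_le_left _ _
  have hδ2 : δ ≤ c * η / 2 := min_le_right _ _
  set h : E := (1 / 2 : ℝ) • (x + y) with hh
  have : Nonempty ι := ⟨i₀⟩
  -- An index almost attaining the supremum at the midpoint; the gap at `x` will force it to be
  -- `i₀`.
  obtain ⟨i, hi⟩ := exists_lt_of_lt_ciSup
    (show (⨆ i, (φ i h + c * ψ i h)) - δ < ⨆ i, (φ i h + c * ψ i h) by linarith)
  have hx := le_ciSup (bdd x) i
  have hx0 := le_ciSup (bdd x) i₀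
  have hyi := le_ciSup (bdd y) i
  have dφ := (hφ i).convexOn.defect_nonneg x y
  have dψ := (hψ i).convexOn.defect_nonneg x y
  unfold defect at hy dφ
  simp only [← hh] at hy dφ hx hx0 hyi
  have hmul := mul_nonneg hc.le dψ
  unfold defect at hmul
  simp only [← hh] at hmul
  -- By convexity the `i`-th term at `x` is within `4 * δ ≤ κ - c * ‖x‖ ^ 2` of the supremum, while
  -- for `i ≠ i₀` it falls short by at least that amount.
  have hii : i = i₀ := by
    by_contra hne
    have h1 := hκ i hne
    have h2 := mul_le_mul_of_nonneg_left ((hψ i).le x) hc.le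
    have h3 := mul_nonneg hc.le ((hψ i₀).nonneg x)
    linarith
  subst hii
  have : c * defect (ψ i) x y < c * η := by
    unfold defect
    simp only [← hh]
    linarith
  exact lt_of_mul_lt_mul_left this hc.le

/-- The root of `Q` is subadditive: convexity is applied to `x` and `y` scaled to `Q = 1`, with
weights proportional to the roots of `Q x` and `Q y`. -/
theorem ConvexOn.exists_seminorm_sq_eq {Q : E → ℝ} (hQ : ConvexOn ℝ Set.univ Q)
    (smul : ∀ (c : ℝ) (x : E), Q (c • x) = c ^ 2 * Q x) {C : ℝ}
    (hl : ∀ x, ‖x‖ ^ 2 ≤ Q x) (hu : ∀ x, Q x ≤ C ^ 2 * ‖x‖ ^ 2) (hC : 0 < C) :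
    ∃ N : Seminorm ℝ E, IsEquivalentNorm N ∧ ∀ x, N x ^ 2 = Q x := by
  have nn : ∀ x, 0 ≤ Q x := fun x => (sq_nonneg _).trans (hl x)
  have hsm : ∀ (c : ℝ) (x : E), √(Q (c • x)) = ‖c‖ * √(Q x) := fun c x => by
    rw [smul, Real.sqrt_mul (sq_nonneg _), Real.sqrt_sq_eq_abs, Real.norm_eq_abs]
  have pos : ∀ x, x ≠ 0 → 0 < √(Q x) := fun x hx =>
    Real.sqrt_pos.2 (lt_of_lt_of_le (by positivity) (hl x))
  have h0 : √(Q 0) = 0 := by simpa using hsm 0 0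
  have hadd : ∀ x y, √(Q (x + y)) ≤ √(Q x) + √(Q y) := by
    intro x y
    by_cases hx : x = 0
    · simp [hx, h0]
    by_cases hy : y = 0
    · simp [hy, h0]
    have px := pos x hx
    have py := pos y hy
    set a := √(Q x) with ha
    set b := √(Q y) with hb
    have hQa : Q x = a ^ 2 := (Real.sq_sqrt (nn x)).symm
    have hQb : Q y = b ^ 2 := (Real.sq_sqrt (nn y)).symm
    refine Real.sqrt_le_iff.2 ⟨by positivity, ?_⟩
    have key := hQ.2 (Set.mem_univ (a⁻¹ • x)) (Set.mem_univ (b⁻¹ • y))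
      (by positivity : 0 ≤ a / (a + b)) (by positivity : 0 ≤ b / (a + b)) (by field_simp)
    have e : (a / (a + b)) • a⁻¹ • x + (b / (a + b)) • b⁻¹ • y = (a + b)⁻¹ • (x + y) := by
      rw [smul_smul, smul_smul, smul_add]
      congr 2 <;> field_simp
    rw [e, smul, smul, smul, hQa, hQb] at key
    have e2 : (a / (a + b)) • (a⁻¹ ^ 2 * a ^ 2) + (b / (a + b)) • (b⁻¹ ^ 2 * b ^ 2) = 1 := by
      simp only [smul_eq_mul]
      field_simp
    rw [e2, inv_pow, inv_mul_le_iff₀ (by positivity)] at key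
    linarith
  refine ⟨Seminorm.of (fun x => √(Q x)) hadd hsm, ⟨1, C, one_pos, hC, fun x => ⟨?_, ?_⟩⟩,
    fun x => ?_⟩
  · rw [one_mul]
    exact Real.le_sqrt_of_sq_le (hl x)
  · exact Real.sqrt_le_iff.2 ⟨by positivity, by rw [mul_pow]; exact hu x⟩
  · exact Real.sq_sqrt (nn x)

end Gauges

/-! ### Isolated covers by sets of small `d`-diameter. -/

/-- A cover of `X` by countably many families of sets, each family `piece n` being isolated by
the open sets `nhd n x`. -/
structure IsolatedCover (X : Type*) [TopologicalSpace X] where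
  piece : ℕ → X → Set X
  nhd : ℕ → X → Set X
  isOpen_nhd : ∀ n x, IsOpen (nhd n x)
  piece_subset : ∀ n x, piece n x ⊆ nhd n x
  eq_of_mem : ∀ n x y z, z ∈ nhd n x → z ∈ piece n y → x = y
  exists_mem : ∀ z, ∃ n x, z ∈ piece n x

theorem exists_isOpen_inter_of_generateFrom {X : Type*} [TopologicalSpace X] {B : ℕ → Set X}
    {U : Set X}
    (hU : IsOpen[TopologicalSpace.generateFrom ({V : Set X | IsOpen V} ∪ Set.range B)] U)
    {x : X} (hx : x ∈ U) :
    ∃ (s : Finset ℕ) (V : Set X), IsOpen V ∧ x ∈ V ∧ (∀ i ∈ s, x ∈ B i) ∧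
      ∀ y ∈ V, (∀ i ∈ s, y ∈ B i) → y ∈ U := by
  classical
  induction hU with
  | basic W hW =>
    rcases hW with hW | ⟨n, rfl⟩
    · exact ⟨∅, W, hW, hx, by simp, fun y hy _ => hy⟩
    · exact ⟨{n}, Set.univ, isOpen_univ, trivial, by simpa using hx, fun y _ h => h n (by simp)⟩
  | univ => exact ⟨∅, Set.univ, isOpen_univ, trivial, by simp, fun _ _ _ => trivial⟩
  | inter S T _ _ ihS ihT =>
    obtain ⟨s, V, hV, hxV, hs, h⟩ := ihS hx.1
    obtain ⟨t, W, hW, hxW, ht, h'⟩ := ihT hx.2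
    refine ⟨s ∪ t, V ∩ W, hV.inter hW, ⟨hxV, hxW⟩, ?_, fun y hy hst => ⟨?_, ?_⟩⟩
    · intro i hi
      rcases Finset.mem_union.1 hi with hi | hi
      exacts [hs i hi, ht i hi]
    · exact h y hy.1 fun i hi => hst i (Finset.mem_union_left _ hi)
    · exact h' y hy.2 fun i hi => hst i (Finset.mem_union_right _ hi)
  | sUnion S _ ih =>
    obtain ⟨T, hT, hxT⟩ := hx
    obtain ⟨s, V, hV, hxV, hs, h⟩ := ih T hT hxT
    exact ⟨s, V, hV, hxV, hs, fun y hy hst => ⟨T, hT, h y hy hst⟩⟩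

/-- As in Stone's proof that metric spaces are paracompact, a well-ordering assigns each point to
the first centre within `ε / 2`. Keeping a margin `1 / (k + 1)` puts points of different centres at
least that far apart. A finite set `s` of indices is then fixed such that, inside the `B i` with `i
∈ s`, an open set of the original topology already stays within this margin. -/
theorem PropertyP.exists_isolatedCover {X : Type*} [TopologicalSpace X] {d : X → X → ℝ}
    (hP : PropertyP X d) {ε : ℝ} (hε : 0 < ε) :
    ∃ 𝒞 : IsolatedCover X, ∀ n x, ∀ y ∈ 𝒞.piece n x, ∀ z ∈ 𝒞.piece n x, d y z < ε := by
  obtain ⟨B, hB⟩ := hP.exists_seq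
  have tri := hP.isMetric.triangle
  have sym := hP.isMetric.symm
  let near : ℕ → X → Set X := fun k x =>
    {y | d x y < ε / 2 - 1 / ((k : ℝ) + 1) ∧ ∀ x', WellOrderingRel x' x → ε / 2 ≤ d x' y}
  let iso : ℕ → Finset ℕ → X → Set X → Prop := fun k s y V =>
    IsOpen V ∧ y ∈ V ∧ ∀ z ∈ V, (∀ i ∈ s, z ∈ B i) → d y z < 1 / ((k : ℝ) + 1)
  have sep : ∀ k x x' y z, y ∈ near k x → z ∈ near k x' → d y z < 1 / ((k : ℝ) + 1) →
      x = x' := by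
    intro k x x' y z hy hz hyz
    rcases trichotomous_of WellOrderingRel x x' with h | h | h
    · have h1 := hz.2 x h
      have h2 := tri x y z
      have h3 := hy.1
      linarith
    · exact h
    · have h1 := hy.2 x' h
      have h2 := tri x' z y
      have h3 := hz.1
      rw [sym z y] at h2
      linarith
  obtain ⟨code, hcode⟩ : ∃ code : ℕ → ℕ × Finset ℕ, code.Surjective :=
    exists_surjective_nat _
  let P : ℕ × Finset ℕ → X → Set X := fun c x =>
    {y | y ∈ near c.1 x ∧ (∀ i ∈ c.2, y ∈ B i) ∧ ∃ V, iso c.1 c.2 y V}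
  refine ⟨⟨fun n => P (code n),
    fun n x => ⋃₀ {V | ∃ y ∈ P (code n) x, iso (code n).1 (code n).2 y V}, ?_, ?_, ?_, ?_⟩, ?_⟩
  · rintro n x
    refine isOpen_sUnion ?_
    rintro V ⟨y, -, hV⟩
    exact hV.1
  · rintro n x y hy
    obtain ⟨V, hV⟩ := hy.2.2
    exact ⟨V, ⟨y, hy, hV⟩, hV.2.1⟩
  · rintro n x y z ⟨V, ⟨u, hu, hV⟩, hz⟩ hzy
    exact sep _ _ _ u z hu.1 hzy.1 (hV.2.2 z hz hzy.2.1)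
  · intro z
    have hself : d z z = 0 := (hP.isMetric.eq_zero_iff z z).2 rfl
    obtain ⟨x, hx, hmin⟩ := (IsWellFounded.wf (r := (WellOrderingRel : X → X → Prop))).has_min
      {x | d x z < ε / 2} ⟨z, by show d z z < _; rw [hself]; positivity⟩
    obtain ⟨k, hk⟩ := exists_nat_one_div_lt (show 0 < ε / 2 - d x z from sub_pos.2 hx)
    have hopen : MetricOpen d {y | d z y < 1 / ((k : ℝ) + 1)} := by
      intro y hy
      refine ⟨1 / ((k : ℝ) + 1) - d z y, sub_pos.2 hy, fun u hu => ?_⟩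
      have := tri z y u
      show d z u < _
      linarith
    obtain ⟨s, V, hV, hzV, hs, h⟩ := exists_isOpen_inter_of_generateFrom (hB _ hopen) (x := z)
      (by show d z z < _; rw [hself]; positivity)
    obtain ⟨n, hc⟩ := hcode (k, s)
    refine ⟨n, x, ?_⟩
    show z ∈ P (code n) x
    rw [hc]
    refine ⟨⟨by show d x z < ε / 2 - 1 / ((k : ℝ) + 1); linarith, fun x' hx' => ?_⟩, hs,
      V, hV, hzV, h⟩
    exact not_lt.1 fun hlt => hmin x' hlt hx'
  · rintro n x y hy z hz
    have h1 := hy.1.1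
    have h2 := hz.1.1
    have h3 := tri y x z
    rw [sym y x] at h3
    have : 0 < 1 / (((code n).1 : ℝ) + 1) := by positivity
    show d y z < ε
    linarith

/-! ### Types of closed sets, and their stability under compactness. -/

namespace IsolatedCover

variable {X : Type*} [TopologicalSpace X] (𝒞 : IsolatedCover X)

/-- The closure of the union of the `n`-th family. -/
def total (n : ℕ) : Set X := closure (⋃ x, 𝒞.piece n x)

/-- The part of `total n` which the isolating open sets do not reach. -/
def rest (n : ℕ) : Set X := 𝒞.total n \ ⋃ x, 𝒞.nhd n x

/-- The closed set of the points of `total n` in all `rest i`, `i ∈ s`. -/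
def upper (τ : Finset ℕ × ℕ) : Set X := (⋂ i ∈ τ.1, 𝒞.rest i) ∩ 𝒞.total τ.2

/-- The closed subset of `upper` which the isolating open sets do not reach. -/
def lower (τ : Finset ℕ × ℕ) : Set X := (⋂ i ∈ τ.1, 𝒞.rest i) ∩ 𝒞.rest τ.2

/-- The set `N` meets `upper τ`, and only at points reached by the isolating open sets. -/
def Detects (τ : Finset ℕ × ℕ) (N : Set X) : Prop :=
  (N ∩ 𝒞.upper τ).Nonempty ∧ ¬ (N ∩ 𝒞.lower τ).Nonempty

/-- The first `τ` which detects `N`. -/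
noncomputable def type (N : Set X) : Finset ℕ × ℕ :=
  Denumerable.ofNat (Finset ℕ × ℕ) (sInf {k | 𝒞.Detects (Denumerable.ofNat (Finset ℕ × ℕ) k) N})

theorem isClosed_total (n : ℕ) : IsClosed (𝒞.total n) := isClosed_closure

theorem isClosed_rest (n : ℕ) : IsClosed (𝒞.rest n) :=
  (𝒞.isClosed_total n).sdiff (isOpen_iUnion fun x => 𝒞.isOpen_nhd n x)

theorem isClosed_upper (τ : Finset ℕ × ℕ) : IsClosed (𝒞.upper τ) :=
  (isClosed_biInter fun i _ => 𝒞.isClosed_rest i).inter (𝒞.isClosed_total _)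

theorem isClosed_lower (τ : Finset ℕ × ℕ) : IsClosed (𝒞.lower τ) :=
  (isClosed_biInter fun i _ => 𝒞.isClosed_rest i).inter (𝒞.isClosed_rest _)

theorem mem_closure_piece {n : ℕ} {x z : X} (hz : z ∈ 𝒞.nhd n x) (hz' : z ∈ 𝒞.total n) :
    z ∈ closure (𝒞.piece n x) := by
  refine closure_mono ?_ ((𝒞.isOpen_nhd n x).inter_closure ⟨hz, hz'⟩)
  rintro y ⟨hy, hy'⟩
  obtain ⟨u, hu⟩ := Set.mem_iUnion.1 hy'
  rwa [𝒞.eq_of_mem n x u y hy hu]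

/-- Isolation survives passing to the closure: the open set `nhd n x ∩ nhd n y` around `z` meets
some piece, whose index must equal both `x` and `y`. -/
theorem eq_of_mem_nhd {n : ℕ} {x y z : X} (hx : z ∈ 𝒞.nhd n x) (hy : z ∈ 𝒞.nhd n y)
    (hz : z ∈ 𝒞.total n) : x = y := by
  obtain ⟨u, ⟨hu, hu'⟩, hu''⟩ := mem_closure_iff.1 hz _
    ((𝒞.isOpen_nhd n x).inter (𝒞.isOpen_nhd n y)) ⟨hx, hy⟩
  obtain ⟨v, hv⟩ := Set.mem_iUnion.1 hu''
  rw [𝒞.eq_of_mem n x v u hu hv, 𝒞.eq_of_mem n y v u hu' hv]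

theorem exists_mem_nhd {τ : Finset ℕ × ℕ} {z : X} (hz : z ∈ 𝒞.upper τ) (hz' : z ∉ 𝒞.lower τ) :
    ∃ x, z ∈ 𝒞.nhd τ.2 x := by
  by_contra! h
  exact hz' ⟨hz.1, hz.2, by simpa using h⟩

/-- The closure of the union of the pieces with indices in `F`. -/
def closurePieces (n : ℕ) (F : Finset X) : Set X :=
  closure (⋃ x ∈ F, 𝒞.piece n x)

theorem exists_of_mem_closurePieces {n : ℕ} {F : Finset X}
    {z : X} (hz : z ∈ 𝒞.closurePieces n F) : ∃ x ∈ F, z ∈ closure (𝒞.piece n x) := by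
  unfold closurePieces at hz
  rw [Finset.closure_biUnion] at hz
  simpa using hz

/-- Greedily collect the indices `n` whose `rest n` still meets what remains of `N`. By compactness
a point `z` survives all stages. It lies in a piece of some family `n`, hence outside `rest n`, so
`n` was rejected; at that stage `(s n, n)` detects `N`. -/
theorem exists_detects [CompactSpace X] {N : Set X} (hN : IsClosed N) (hne : N.Nonempty) :
    ∃ τ, 𝒞.Detects τ N := by
  classical
  by_contra! H
  let s : ℕ → Finset ℕ := fun n => Nat.rec ∅ (fun n s =>
    if ((N ∩ ⋂ i ∈ s, 𝒞.rest i) ∩ 𝒞.rest n).Nonempty then insert n s else s) n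
  have hs : ∀ n, s (n + 1) = if ((N ∩ ⋂ i ∈ s n, 𝒞.rest i) ∩ 𝒞.rest n).Nonempty
      then insert n (s n) else s n := fun n => rfl
  have hne' : ∀ n, (N ∩ ⋂ i ∈ s n, 𝒞.rest i).Nonempty := by
    intro n
    induction n with
    | zero => simpa [s] using hne
    | succ n ih =>
      rw [hs]
      split_ifs with h
      · obtain ⟨z, ⟨hz, hz'⟩, hz''⟩ := h
        refine ⟨z, hz, ?_⟩
        rw [Finset.set_biInter_insert]
        exact ⟨hz'', hz'⟩
      · exact ih
  have hcl : ∀ n, IsClosed (N ∩ ⋂ i ∈ s n, 𝒞.rest i) := fun n =>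
    hN.inter (isClosed_biInter fun i _ => 𝒞.isClosed_rest i)
  obtain ⟨z, hz⟩ := IsCompact.nonempty_iInter_of_sequence_nonempty_isCompact_isClosed
    (fun n => N ∩ ⋂ i ∈ s n, 𝒞.rest i) (fun n => by
      refine Set.inter_subset_inter_right _ (Set.biInter_subset_biInter_left ?_)
      intro i hi
      show i ∈ s (n + 1)
      rw [hs]
      split_ifs
      · exact Finset.mem_insert_of_mem hi
      · exact hi) hne' (hcl 0).isCompact hcl
  rw [Set.mem_iInter] at hz
  obtain ⟨n, x, hx⟩ := 𝒞.exists_mem z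
  have hzt : z ∈ 𝒞.total n := subset_closure (Set.mem_iUnion.2 ⟨x, hx⟩)
  have h1 : ((N ∩ ⋂ i ∈ s n, 𝒞.rest i) ∩ 𝒞.rest n).Nonempty := by
    by_contra h
    refine H (s n, n) ⟨⟨z, (hz n).1, (hz n).2, hzt⟩, fun ⟨y, hy, hy', hy''⟩ =>
      h ⟨y, ⟨hy, hy'⟩, hy''⟩⟩
  have h2 := (hz (n + 1)).2
  rw [hs, if_pos h1, Finset.set_biInter_insert] at h2
  exact h2.1.2 (Set.mem_iUnion.2 ⟨x, 𝒞.piece_subset n x hx⟩)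

theorem detects_type [CompactSpace X] {N : Set X} (hN : IsClosed N) (hne : N.Nonempty) :
    𝒞.Detects (𝒞.type N) N := by
  obtain ⟨τ, hτ⟩ := 𝒞.exists_detects hN hne
  obtain ⟨k, rfl⟩ := (Denumerable.eqv (Finset ℕ × ℕ)).symm.surjective τ
  exact Nat.sInf_mem (s := {k | 𝒞.Detects (Denumerable.ofNat (Finset ℕ × ℕ) k) N}) ⟨k, hτ⟩

end IsolatedCover

/-- Detection only asks whether `N` meets two given closed sets, so this makes each single instance
of detection eventually constant. -/
theorem eventually_nonempty_inter_iff {X : Type*} [TopologicalSpace X] [CompactSpace X]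
    {N : ℕ → Set X} (hN : ∀ i, IsClosed (N i)) (hanti : Antitone N) {C : Set X}
    (hC : IsClosed C) : ∀ᶠ i in atTop, ((N i ∩ C).Nonempty ↔ ((⋂ i, N i) ∩ C).Nonempty) := by
  by_cases h : ∀ i, (N i ∩ C).Nonempty
  · obtain ⟨z, hz⟩ := IsCompact.nonempty_iInter_of_sequence_nonempty_isCompact_isClosed
      (fun n => N n ∩ C) (fun n => Set.inter_subset_inter_left _ (hanti n.le_succ)) h
      ((hN 0).inter hC).isCompact fun n => (hN n).inter hC
    rw [Set.mem_iInter] at hz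
    exact Eventually.of_forall fun i =>
      ⟨fun _ => ⟨z, Set.mem_iInter.2 fun j => (hz j).1, (hz 0).2⟩, fun _ => h i⟩
  · push Not at h
    obtain ⟨i, hi⟩ := h
    filter_upwards [eventually_ge_atTop i] with j hj
    refine ⟨fun ⟨z, hz, hz'⟩ => ?_, fun ⟨z, hz, hz'⟩ => ⟨z, Set.mem_iInter.1 hz j, hz'⟩⟩
    exact absurd (show z ∈ N i ∩ C from ⟨hanti hj hz, hz'⟩) (by simp [hi])

/-- Along a decreasing sequence of closed sets the type is eventually constant. -/
theorem IsolatedCover.eventually_inter_upper_type_nonempty {X : Type*} [TopologicalSpace X]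
    [CompactSpace X] (𝒞 : IsolatedCover X) {N : ℕ → Set X} (hN : ∀ i, IsClosed (N i))
    (hanti : Antitone N) :
    ∀ᶠ i in atTop, (N i).Nonempty → (N (i + 1) ∩ 𝒞.upper (𝒞.type (N i))).Nonempty := by
  have hcl : IsClosed (⋂ i, N i) := isClosed_iInter hN
  by_cases hne : (⋂ i, N i).Nonempty
  · set D : Set X → Set ℕ := fun M =>
      {k | 𝒞.Detects (Denumerable.ofNat (Finset ℕ × ℕ) k) M} with hD
    set m := sInf (D (⋂ i, N i)) with hm
    have hev : ∀ k, ∀ᶠ i in atTop, (k ∈ D (N i) ↔ k ∈ D (⋂ i, N i)) := by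
      intro k
      filter_upwards [eventually_nonempty_inter_iff hN hanti (𝒞.isClosed_upper _),
        eventually_nonempty_inter_iff hN hanti (𝒞.isClosed_lower _)] with i h1 h2
      exact and_congr h1 (not_congr h2)
    have hmem : m ∈ D (⋂ i, N i) := by
      obtain ⟨τ, hτ⟩ := 𝒞.exists_detects hcl hne
      obtain ⟨k, rfl⟩ := (Denumerable.eqv (Finset ℕ × ℕ)).symm.surjective τ
      exact Nat.sInf_mem ⟨k, hτ⟩
    -- Only the finitely many codes up to `m` need to have stabilised for the first detecting code
    -- of `N i` to be `m`.
    filter_upwards [(Set.finite_Iic m).eventually_all.2 fun k _ => hev k] with i hi _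
    have : sInf (D (N i)) = m := by
      have hmi : m ∈ D (N i) := (hi m Set.self_mem_Iic).2 hmem
      refine le_antisymm (Nat.sInf_le hmi) ?_
      have h1 := Nat.sInf_mem ⟨m, hmi⟩
      exact Nat.sInf_le ((hi _ (Nat.sInf_le hmi)).1 h1)
    have htype : 𝒞.type (N i) = 𝒞.type (⋂ i, N i) := by
      unfold IsolatedCover.type
      exact congrArg _ this
    rw [htype]
    exact (𝒞.detects_type hcl hne).1.mono
      (Set.inter_subset_inter_left _ (Set.iInter_subset _ _))
  · filter_upwards [eventually_nonempty_inter_iff hN hanti isClosed_univ] with i hi h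
    simp only [Set.inter_univ] at hi
    exact absurd (hi.1 h) hne

/-! ### Programs and the convex functions they define. -/

/-- A recipe for a convex function on `C(K, ℝ)`, see `Program.gauge`. -/
inductive Program : Type
  | leaf : Program
  | node (l : ℕ) (σ τ : Finset ℕ × ℕ) (j k m : ℕ) (p q : Program) : Program
  deriving Encodable

/-- An open set containing `C` whose closure misses `D`, if there is one. -/
noncomputable def separator {X : Type*} [TopologicalSpace X] (C D : Set X) : Set X :=
  open Classical in
  if h : ∃ V : Set X, IsOpen V ∧ C ⊆ V ∧ Disjoint (closure V) D then h.choose else ∅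

theorem separator_spec {X : Type*} [TopologicalSpace X] [NormalSpace X] {C D : Set X}
    (hC : IsClosed C) (hD : IsClosed D) (h : Disjoint C D) :
    IsOpen (separator C D) ∧ C ⊆ separator C D ∧ Disjoint (closure (separator C D)) D := by
  have H : ∃ V : Set X, IsOpen V ∧ C ⊆ V ∧ Disjoint (closure V) D := by
    obtain ⟨V, hV, hCV, hVD⟩ := normal_exists_closure_subset hC hD.isOpen_compl
      (Set.disjoint_left.1 h)
    exact ⟨V, hV, hCV, Set.disjoint_left.2 fun x hx => hVD hx⟩
  unfold separator
  rw [dif_pos H]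
  exact H.choose_spec

section Gauges

variable {K : Type*} [TopologicalSpace K] [CompactSpace K]

/-- A nonnegative version of the supremum over `S`. -/
noncomputable def supGauge (S : Set K) (g : C(K, ℝ)) : ℝ := ⨆ x : S, (‖g‖ + g x) / 2

theorem isGauge_supGauge (S : Set K) : IsGauge (supGauge S) := by
  refine IsGauge.iSup fun x => ⟨⟨convex_univ, fun f _ g _ a b ha hb hab => ?_⟩,
    fun c hc f => ?_, fun f => ?_, fun f => ?_⟩
  · have h1 := norm_add_le (a • f) (b • g)
    rw [norm_smul, norm_smul, Real.norm_of_nonneg ha, Real.norm_of_nonneg hb] at h1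
    simp only [ContinuousMap.add_apply, ContinuousMap.smul_apply, smul_eq_mul]
    linarith
  · simp only [ContinuousMap.smul_apply, smul_eq_mul, norm_smul, Real.norm_of_nonneg hc]
    ring
  · have := f.neg_norm_le_apply x
    linarith
  · have := f.apply_le_norm x
    linarith

theorem le_supGauge {S : Set K} (g : C(K, ℝ)) {x : K} (hx : x ∈ S) :
    (‖g‖ + g x) / 2 ≤ supGauge S g := by
  refine le_ciSup (f := fun x : S => (‖g‖ + g x) / 2) ⟨‖g‖, ?_⟩ ⟨x, hx⟩
  rintro _ ⟨y, rfl⟩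
  have := g.apply_le_norm y
  show (‖g‖ + g y) / 2 ≤ ‖g‖
  linarith

theorem supGauge_le {S : Set K} {g : C(K, ℝ)} {c : ℝ} (hc : 0 ≤ ‖g‖ + c)
    (h : ∀ x ∈ S, g x ≤ c) : supGauge S g ≤ (‖g‖ + c) / 2 :=
  Real.iSup_le (fun x => by linarith [h x x.2]) (by linarith)

/-- The mean over `F` of the suprema over the pieces of `upper σ ∩ L`. -/
noncomputable def meanGauge (𝒞 : IsolatedCover K) (σ : Finset ℕ × ℕ) (L : Set K) (F : Finset K)
    (g : C(K, ℝ)) : ℝ :=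
  (∑ x ∈ F, supGauge (𝒞.nhd σ.2 x ∩ 𝒞.upper σ ∩ L) g) / F.card

theorem isGauge_meanGauge (𝒞 : IsolatedCover K) (σ : Finset ℕ × ℕ) (L : Set K) (F : Finset K) :
    IsGauge (meanGauge 𝒞 σ L F) :=
  IsGauge.sum_div (fun _ => isGauge_supGauge _) F le_rfl

/-- The convex function on `C(K, ℝ)` which a program assigns to a set `L`. A node chooses
two finite families of pieces, separates them by an open set `V`, and evaluates the two
subprograms on `L ∩ closure V` and `L \ V`. -/
noncomputable def Program.gauge (𝒞 : ℕ → IsolatedCover K) : Program → Set K → C(K, ℝ) → ℝ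
  | leaf, L, g => (1 / 2) * ‖g‖ ^ 2 +
      (1 / 2) * ((1 / 2) * supGauge L g ^ 2 + (1 / 2) * supGauge L (-g) ^ 2)
  | node l σ τ j k m p q, L, g =>
      ⨆ i : {i : Finset K × Finset K // i.1.card = j ∧ i.2.card = k},
        ((1 / 2) * ((1 / 2) * meanGauge (𝒞 l) σ L i.1.1 g ^ 2 +
            (1 / 2) * meanGauge (𝒞 l) τ L i.1.2 (-g) ^ 2) +
          (1 / 2) ^ (m + 1) * ((1 / 2) * p.gauge 𝒞 (L ∩ closure (separator
              ((𝒞 l).closurePieces σ.2 i.1.1) ((𝒞 l).closurePieces τ.2 i.1.2))) g +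
            (1 / 2) * q.gauge 𝒞 (L \ separator
              ((𝒞 l).closurePieces σ.2 i.1.1) ((𝒞 l).closurePieces τ.2 i.1.2)) g))

theorem Program.isSquareGauge_gauge (𝒞 : ℕ → IsolatedCover K) (p : Program) :
    ∀ L, IsSquareGauge (p.gauge 𝒞 L) := by
  induction p with
  | leaf =>
    intro L
    exact IsGauge.norm.sq.combination
      ((isGauge_supGauge L).sq.combination (isGauge_supGauge L).comp_neg.sq
        (by norm_num) (by norm_num) (by norm_num)) (by norm_num) (by norm_num) (by norm_num)
  | node l σ τ j k m p q hp hq =>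
    intro L
    refine IsSquareGauge.iSup fun i => ?_
    refine ((isGauge_meanGauge (𝒞 l) σ L i.1.1).sq.combination
      (isGauge_meanGauge (𝒞 l) τ L i.1.2).comp_neg.sq
      (by norm_num) (by norm_num) (by norm_num)).combination
      ((hp _).combination (hq _) (by norm_num) (by norm_num) (by norm_num))
      (by norm_num) (by positivity) ?_
    have : (1 / 2 : ℝ) ^ m ≤ 1 := pow_le_one₀ (by norm_num) (by norm_num)
    rw [pow_succ]
    linarith

/-- Small defect at `f` of the function of `p` at `L` bounds the distance to `f` on `L`. -/
def Program.Controls (𝒞 : ℕ → IsolatedCover K) (f : C(K, ℝ)) (e : ℝ) (p : Program)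
    (L : Set K) : Prop :=
  ∃ δ > 0, ∀ g, defect (p.gauge 𝒞 L) f g < δ → ∀ x ∈ L, |f x - g x| ≤ e

/-- A small defect makes the norm and both suprema at `g` differ by at most `e / 6` from those at
`f`. Since `g x ≤ 2 * supGauge L g - ‖g‖`, this gives `g x ≤ f x + e / 2 + 2 * (e / 6) + e / 6`, and
the same for `-g`. -/
theorem Program.controls_leaf (𝒞 : ℕ → IsolatedCover K) {f : C(K, ℝ)} {e : ℝ} (he : 0 < e)
    {L : Set K} (h : ∀ x ∈ L, ∀ y ∈ L, f x - f y ≤ e / 2) : leaf.Controls 𝒞 f e L := by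
  have key : ∀ (p : C(K, ℝ) → ℝ), IsGauge p → ∀ g,
      (1 / 4) * defect (fun z => p z ^ 2) f g < (e / 24) ^ 2 → |p f - p g| ≤ e / 6 := by
    intro p hp g hg
    have := hp.sq_sub_le_defect f g
    refine abs_le_of_sq_le_sq ?_ (by positivity)
    nlinarith
  refine ⟨(e / 24) ^ 2, by positivity, fun g hg x hx => ?_⟩
  have hA := isGauge_supGauge L
  have hB := hA.comp_neg
  have d0 := (IsGauge.norm (E := C(K, ℝ))).sq.convexOn.defect_nonneg f g
  have dA := hA.sq.convexOn.defect_nonneg f g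
  have dB := hB.sq.convexOn.defect_nonneg f g
  have hsum : defect (leaf.gauge 𝒞 L) f g = (1 / 2) * defect (fun z => ‖z‖ ^ 2) f g +
      (1 / 2) * ((1 / 2) * defect (fun z => supGauge L z ^ 2) f g +
        (1 / 2) * defect (fun z => supGauge L (-z) ^ 2) f g) := by
    unfold defect Program.gauge
    ring
  rw [hsum] at hg
  have k0 := abs_le.1 (key _ IsGauge.norm g (by linarith))
  have kA := abs_le.1 (key _ hA g (by linarith))
  have kB := abs_le.1 (key _ hB g (by linarith))
  have gA := le_supGauge g hx
  have gB := le_supGauge (-g) hx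
  have fn := f.neg_norm_le_apply x
  have fn' := f.apply_le_norm x
  have fA : supGauge L f ≤ (‖f‖ + (f x + e / 2)) / 2 :=
    supGauge_le (by linarith) fun y hy => by linarith [h y hy x hx]
  have fB : supGauge L (-f) ≤ (‖-f‖ + (-f x + e / 2)) / 2 :=
    supGauge_le (by rw [norm_neg]; linarith) fun y hy => by
      rw [ContinuousMap.neg_apply]; linarith [h x hx y hy]
  rw [norm_neg] at fB gB
  rw [ContinuousMap.neg_apply] at gB
  rw [abs_le]
  constructor <;> linarith

/-- Passing from `F` to `G` exchanges equally many elements, at least one, and each exchange loses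
at least `κ`. -/
theorem Finset.sum_add_le_sum_of_threshold {ι : Type*} {m : ι → ℝ} {F G : Finset ι} {t κ : ℝ}
    (hF : ∀ x ∈ F, t ≤ m x) (hG : ∀ x ∉ F, m x ≤ t - κ) (hκ : 0 ≤ κ) (hcard : G.card = F.card)
    (hne : G ≠ F) : ∑ x ∈ G, m x + κ ≤ ∑ x ∈ F, m x := by
  classical
  have h1 := Finset.sum_sdiff_sub_sum_sdiff (s₁ := F) (s₂ := G) (f := m)
  have hc : (F \ G).card = (G \ F).card := Finset.card_sdiff_comm hcard.symm
  have hpos : 0 < (G \ F).card := by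
    rw [Finset.card_pos, Finset.sdiff_nonempty]
    exact fun hs => hne (Finset.eq_of_subset_of_card_le hs hcard.ge)
  have h2 : ∑ x ∈ G \ F, m x ≤ (G \ F).card * (t - κ) := by
    simpa using Finset.sum_le_card_nsmul (G \ F) m (t - κ) fun x hx =>
      hG x (Finset.mem_sdiff.1 hx).2
  have h3 : (G \ F).card * t ≤ ∑ x ∈ F \ G, m x := by
    simpa [hc] using Finset.card_nsmul_le_sum (F \ G) m t fun x hx =>
      hF x (Finset.mem_sdiff.1 hx).1
  have h4 : (1 : ℝ) ≤ (G \ F).card := by exact_mod_cast hpos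
  nlinarith

theorem meanGauge_sq_gap (𝒞 : IsolatedCover K) (σ : Finset ℕ × ℕ) (L : Set K) (F : Finset K)
    (f : C(K, ℝ)) {t κ : ℝ} (hκ : 0 < κ)
    (hF : ∀ x ∈ F, t ≤ supGauge (𝒞.nhd σ.2 x ∩ 𝒞.upper σ ∩ L) f)
    (hG : ∀ x ∉ F, supGauge (𝒞.nhd σ.2 x ∩ 𝒞.upper σ ∩ L) f ≤ t - κ) :
    ∃ κ' > 0, ∀ G : Finset K, G.card = F.card → G ≠ F →
      meanGauge 𝒞 σ L G f ^ 2 + κ' ≤ meanGauge 𝒞 σ L F f ^ 2 := by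
  rcases F.eq_empty_or_nonempty with rfl | hne
  -- The empty family has no competitor of the same size, so any gap will do.
  · exact ⟨1, one_pos, fun G hc hG => absurd (Finset.card_eq_zero.1 hc) hG⟩
  have hpos : (0 : ℝ) < F.card := by exact_mod_cast hne.card_pos
  refine ⟨(κ / F.card) ^ 2, by positivity, fun G hc hGF => ?_⟩
  have h1 := Finset.sum_add_le_sum_of_threshold hF hG hκ.le hc hGF
  have h2 : meanGauge 𝒞 σ L G f + κ / F.card ≤ meanGauge 𝒞 σ L F f := by
    unfold meanGauge
    rw [hc, ← add_div]
    exact div_le_div_of_nonneg_right h1 hpos.le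
  have h3 := (isGauge_meanGauge 𝒞 σ L G).nonneg f
  have h4 : 0 < κ / F.card := by positivity
  nlinarith

/-- The finitely many pieces on which `f` reaches the level `a` within `L`. -/
theorem IsolatedCover.exists_finset_of_detects (𝒞 : IsolatedCover K) {f : C(K, ℝ)} {L : Set K}
    (hL : IsClosed L) {a : ℝ} (ha : 0 < ‖f‖ + a) {σ : Finset ℕ × ℕ}
    (hσ : 𝒞.Detects σ (L ∩ {x | a ≤ f x})) :
    ∃ F : Finset K, (∃ κ' > 0, ∀ G : Finset K, G.card = F.card → G ≠ F →
        meanGauge 𝒞 σ L G f ^ 2 + κ' ≤ meanGauge 𝒞 σ L F f ^ 2) ∧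
      L ∩ {x | a ≤ f x} ∩ 𝒞.upper σ ⊆ 𝒞.closurePieces σ.2 F ∧
      ∀ x ∈ F, ∃ z ∈ closure (𝒞.piece σ.2 x), a ≤ f z := by
  classical
  have hclosed : ∀ c : ℝ, IsClosed (L ∩ {x | c ≤ f x} ∩ 𝒞.upper σ) := fun c =>
    (hL.inter (isClosed_le continuous_const f.continuous)).inter (𝒞.isClosed_upper σ)
  set N := L ∩ {x | a ≤ f x} ∩ 𝒞.upper σ with hN
  obtain ⟨F₀, hF₀⟩ := (hclosed a).isCompact.elim_finite_subcover (fun x => 𝒞.nhd σ.2 x)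
    (𝒞.isOpen_nhd σ.2) fun z hz => Set.mem_iUnion.2
      (𝒞.exists_mem_nhd hz.2 fun hz' => hσ.2 ⟨z, hz.1, hz'⟩)
  -- Indices whose open set misses `N` are dropped, so that every `x ∈ F` has a supremum reaching
  -- the level `a`.
  set F := F₀.filter fun x => (𝒞.nhd σ.2 x ∩ N).Nonempty with hF
  have hNF : N ⊆ ⋃ x ∈ F, 𝒞.nhd σ.2 x := by
    intro z hz
    obtain ⟨x, hx, hzx⟩ := Set.mem_iUnion₂.1 (hF₀ hz)
    exact Set.mem_iUnion₂.2 ⟨x, Finset.mem_filter.2 ⟨hx, z, hzx, hz⟩, hzx⟩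
  have hopen : IsOpen (⋃ x ∈ F, 𝒞.nhd σ.2 x) :=
    isOpen_biUnion fun x _ => 𝒞.isOpen_nhd σ.2 x
  -- The part of `L ∩ upper σ` outside the open sets of `F` is compact and has `f < a`, so `f` stays
  -- below `a - κ` there. The bound `0 ≤ ‖f‖ + (a - κ)` handles empty sets, over which `supGauge` is
  -- `0`.
  obtain ⟨κ, hκ, hκa, hκN⟩ : ∃ κ > 0, 0 ≤ ‖f‖ + (a - κ) ∧
      L ∩ {x | a - κ ≤ f x} ∩ 𝒞.upper σ ⊆ ⋃ x ∈ F, 𝒞.nhd σ.2 x := by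
    set D := (L ∩ 𝒞.upper σ) \ ⋃ x ∈ F, 𝒞.nhd σ.2 x with hD
    have hDc : IsCompact D := ((hL.inter (𝒞.isClosed_upper σ)).sdiff hopen).isCompact
    rcases D.eq_empty_or_nonempty with hDe | hDn
    · refine ⟨‖f‖ + a, ha, by linarith, fun z hz => ?_⟩
      by_contra hz'
      exact absurd (show z ∈ D from ⟨⟨hz.1.1, hz.2⟩, hz'⟩) (by simp [hDe])
    · obtain ⟨y, hy, hmax⟩ := hDc.exists_isMaxOn hDn f.continuous.continuousOn
      have hya : f y < a := by
        by_contra! h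
        exact hy.2 (hNF ⟨⟨hy.1.1, h⟩, hy.1.2⟩)
      refine ⟨min (‖f‖ + a) ((a - f y) / 2), lt_min ha (by linarith),
        by linarith [min_le_left (‖f‖ + a) ((a - f y) / 2)], fun z hz => ?_⟩
      by_contra hz'
      have h1 : f z ≤ f y := hmax (show z ∈ D from ⟨⟨hz.1.1, hz.2⟩, hz'⟩)
      have h2 : a - min (‖f‖ + a) ((a - f y) / 2) ≤ f z := hz.1.2
      linarith [min_le_right (‖f‖ + a) ((a - f y) / 2)]
  refine ⟨F, meanGauge_sq_gap 𝒞 σ L F f (t := (‖f‖ + a) / 2) (half_pos hκ) (fun x hx => ?_)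
    fun x hx => ?_, fun z hz => ?_, fun x hx => ?_⟩
  · obtain ⟨z, hzx, hz⟩ := (Finset.mem_filter.1 hx).2
    have h1 : a ≤ f z := hz.1.2
    have h2 := le_supGauge f (show z ∈ 𝒞.nhd σ.2 x ∩ 𝒞.upper σ ∩ L from ⟨⟨hzx, hz.2⟩, hz.1.1⟩)
    linarith
  · have := supGauge_le (S := 𝒞.nhd σ.2 x ∩ 𝒞.upper σ ∩ L) (g := f) hκa (fun z hz => by
      by_contra! hlt
      obtain ⟨y, hy, hzy⟩ := Set.mem_iUnion₂.1 (hκN ⟨⟨hz.2, hlt.le⟩, hz.1.2⟩)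
      exact hx (𝒞.eq_of_mem_nhd hz.1.1 hzy hz.1.2.2 ▸ hy))
    linarith
  · obtain ⟨x, hx, hzx⟩ := Set.mem_iUnion₂.1 (hNF hz)
    exact closure_mono (Set.subset_biUnion_of_mem (u := fun x => 𝒞.piece σ.2 x) hx)
      (𝒞.mem_closure_piece hzx hz.2.2)
  · obtain ⟨z, hzx, hz⟩ := (Finset.mem_filter.1 hx).2
    exact ⟨z, 𝒞.mem_closure_piece hzx hz.2.2, hz.1.2⟩

/-! ### Splitting a closed set, and termination of the splitting. -/

/-- Splitting a closed set on which `f` oscillates: one part has lost the largest values of `f`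
of a given type, the other part the smallest ones. -/
theorem Program.exists_split [T2Space K] (𝒞 : ℕ → IsolatedCover K) {f : C(K, ℝ)} {l : ℕ}
    {a b ε : ℝ} (hε : a - b > 2 * ε) (hε0 : 0 ≤ ε)
    (hosc : ∀ n x, ∀ y ∈ closure ((𝒞 l).piece n x), ∀ z ∈ closure ((𝒞 l).piece n x),
      f y - f z ≤ ε)
    {L : Set K} (hL : IsClosed L) {σ τ : Finset ℕ × ℕ}
    (hσ : (𝒞 l).Detects σ (L ∩ {x | a ≤ f x})) (hτ : (𝒞 l).Detects τ (L ∩ {x | f x ≤ b}))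
    (e : ℝ) :
    ∃ V : Set K, IsOpen V ∧ ¬ (L ∩ closure V ∩ {x | f x ≤ b} ∩ (𝒞 l).upper τ).Nonempty ∧
      ¬ (L \ V ∩ {x | a ≤ f x} ∩ (𝒞 l).upper σ).Nonempty ∧
      ∀ p q : Program, p.Controls 𝒞 f e (L ∩ closure V) → q.Controls 𝒞 f e (L \ V) →
        ∃ p' : Program, p'.Controls 𝒞 f e L := by
  have hle : ∃ x, a ≤ f x := ⟨hσ.1.some, hσ.1.some_mem.1.2⟩
  have hge : ∃ x, f x ≤ b := ⟨hτ.1.some, hτ.1.some_mem.1.2⟩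
  have ha : 0 < ‖f‖ + a := by
    obtain ⟨x, hx⟩ := hge
    linarith [f.neg_norm_le_apply x]
  have hb : 0 < ‖-f‖ + -b := by
    obtain ⟨x, hx⟩ := hle
    rw [norm_neg]
    linarith [f.apply_le_norm x]
  -- Low values of `f` are treated as high values of `-f`.
  have hset : {x | f x ≤ b} = {x | -b ≤ (-f) x} := by
    ext x; simp
  obtain ⟨F, ⟨κ, hκ, hFgap⟩, hFsub, hFval⟩ := (𝒞 l).exists_finset_of_detects hL ha hσ
  rw [hset] at hτ
  obtain ⟨G, ⟨κ', hκ', hGgap⟩, hGsub, hGval⟩ := (𝒞 l).exists_finset_of_detects hL hb hτ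
  rw [← hset] at hGsub
  -- At a common point, two pieces with oscillation at most `ε` would join a value at least `a` to
  -- one at most `b`, against `a - b > 2 * ε`.
  have hdisj : Disjoint ((𝒞 l).closurePieces σ.2 F) ((𝒞 l).closurePieces τ.2 G) := by
    refine Set.disjoint_left.2 fun z hz hz' => ?_
    obtain ⟨x, hx, hzx⟩ := (𝒞 l).exists_of_mem_closurePieces hz
    obtain ⟨y, hy, hzy⟩ := (𝒞 l).exists_of_mem_closurePieces hz'
    obtain ⟨u, hu, hau⟩ := hFval x hx
    obtain ⟨v, hv, hbv⟩ := hGval y hy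
    have h1 := hosc _ _ u hu z hzx
    have h2 := hosc _ _ z hzy v hv
    rw [ContinuousMap.neg_apply] at hbv
    linarith
  obtain ⟨hVo, hCV, hVD⟩ := separator_spec isClosed_closure isClosed_closure hdisj
  refine ⟨_, hVo, ?_, ?_, fun p q hp hq => ?_⟩
  · rintro ⟨z, ⟨⟨hzL, hzV⟩, hzb⟩, hzu⟩
    exact Set.disjoint_left.1 hVD hzV (hGsub ⟨⟨hzL, hzb⟩, hzu⟩)
  · rintro ⟨z, ⟨⟨hzL, hzV⟩, hza⟩, hzu⟩
    exact hzV (hCV (hFsub ⟨⟨hzL, hza⟩, hzu⟩))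
  -- The subprograms get so small a weight that they cannot offset the gap of the mean gauges. The
  -- squares of these carry weight `1 / 4` each, hence `min κ κ' / 4`.
  · obtain ⟨m, hm⟩ : ∃ m : ℕ, (1 / 2 : ℝ) ^ (m + 1) * ‖f‖ ^ 2 < min κ κ' / 4 := by
      have h0 : Tendsto (fun m : ℕ => (1 / 2 : ℝ) ^ (m + 1) * ‖f‖ ^ 2) atTop (𝓝 (0 * ‖f‖ ^ 2)) :=
        ((tendsto_pow_atTop_nhds_zero_of_lt_one (by norm_num) (by norm_num)).comp
          (tendsto_add_atTop_nat 1)).mul_const _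
      rw [zero_mul] at h0
      exact (h0.eventually_lt_const (by have := lt_min hκ hκ'; positivity)).exists
    let P := node l σ τ F.card G.card m p q
    let i₀ : {i : Finset K × Finset K // i.1.card = F.card ∧ i.2.card = G.card} :=
      ⟨(F, G), rfl, rfl⟩
    have hdom := IsSquareGauge.dominates_of_gap (c := (1 / 2 : ℝ) ^ (m + 1)) (κ := min κ κ' / 4)
      (x := f)
      (φ := fun (i : {i : Finset K × Finset K // i.1.card = F.card ∧ i.2.card = G.card}) g =>
        (1 / 2) * ((1 / 2) * meanGauge (𝒞 l) σ L i.1.1 g ^ 2 +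
            (1 / 2) * meanGauge (𝒞 l) τ L i.1.2 (-g) ^ 2))
      (ψ := fun i g => (1 / 2) * p.gauge 𝒞 (L ∩ closure (separator
              ((𝒞 l).closurePieces σ.2 i.1.1) ((𝒞 l).closurePieces τ.2 i.1.2))) g +
            (1 / 2) * q.gauge 𝒞 (L \ separator
              ((𝒞 l).closurePieces σ.2 i.1.1) ((𝒞 l).closurePieces τ.2 i.1.2)) g)
      i₀ (by positivity)
      (fun i => ((isGauge_meanGauge (𝒞 l) σ L i.1.1).sq.combination
        (isGauge_meanGauge (𝒞 l) τ L i.1.2).comp_neg.sq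
        (by norm_num) (by norm_num) (by norm_num)).const_mul (by norm_num) (by norm_num))
      (fun i => (p.isSquareGauge_gauge 𝒞 _).combination (q.isSquareGauge_gauge 𝒞 _)
        (by norm_num) (by norm_num) (by norm_num))
      (by
        rintro ⟨⟨F', G'⟩, hF', hG'⟩ hne
        have hF1 := hFgap F' hF'
        have hG1 := hGgap G' hG'
        have hmF := min_le_left κ κ'
        have hmG := min_le_right κ κ'
        simp only [i₀]
        by_cases hFF : F' = F
        · by_cases hGG : G' = G
          · exact absurd (by simp only [i₀, hFF, hGG]) hne
          · have := hG1 hGG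
            rw [hFF]
            linarith
        · have := hF1 hFF
          by_cases hGG : G' = G
          · rw [hGG]
            linarith
          · have := hG1 hGG
            linarith) hm
    have hdom' : Dominates f (P.gauge 𝒞 L) _ := hdom
    simp only [i₀] at hdom'
    obtain ⟨half₁, half₂⟩ := (p.isSquareGauge_gauge 𝒞 (L ∩ closure (separator
      ((𝒞 l).closurePieces σ.2 F) ((𝒞 l).closurePieces τ.2 G)))).dominates_half_add_half
      (q.isSquareGauge_gauge 𝒞 (L \ separator
        ((𝒞 l).closurePieces σ.2 F) ((𝒞 l).closurePieces τ.2 G))) f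
    have hd1 := hdom'.trans half₁
    have hd2 := hdom'.trans half₂
    obtain ⟨δ₁, hδ₁, H₁⟩ := hp
    obtain ⟨δ₂, hδ₂, H₂⟩ := hq
    obtain ⟨η₁, hη₁, T₁⟩ := hd1 δ₁ hδ₁
    obtain ⟨η₂, hη₂, T₂⟩ := hd2 δ₂ hδ₂
    refine ⟨P, min η₁ η₂, lt_min hη₁ hη₂, fun g hg x hx => ?_⟩
    by_cases hxV : x ∈ separator ((𝒞 l).closurePieces σ.2 F) ((𝒞 l).closurePieces τ.2 G)
    · exact H₁ g (T₁ g (hg.trans_le (min_le_left _ _))) x ⟨hx, subset_closure hxV⟩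
    · exact H₂ g (T₂ g (hg.trans_le (min_le_right _ _))) x ⟨hx, hxV⟩

/-- If no program controls `K`, then every closed set without a controlling program contains a part,
also without one, that has lost a type at some level. Iterating gives a decreasing sequence that
contradicts the stabilisation of types, because only finitely many levels occur. -/
theorem Program.exists_controls_univ [T2Space K] (𝒞 : ℕ → IsolatedCover K) {f : C(K, ℝ)} {l : ℕ}
    {e : ℝ} (he : 0 < e)
    (hosc : ∀ n x, ∀ y ∈ closure ((𝒞 l).piece n x), ∀ z ∈ closure ((𝒞 l).piece n x),
      f y - f z ≤ e / 8) :
    ∃ p : Program, p.Controls 𝒞 f e Set.univ := by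
  by_contra hbad
  set h : ℝ := e / 8 with hh
  have hpos : 0 < h := by positivity
  -- The extra `1` leaves room for rounding the values of `f` to multiples of `h`.
  set M : ℤ := ⌈‖f‖ / h⌉ + 1 with hM
  let top : ℤ → Set K → Set K := fun z L => L ∩ {x | z * h ≤ f x}
  let bot : ℤ → Set K → Set K := fun z L => L ∩ {x | f x ≤ z * h}
  have htop : ∀ z L, IsClosed L → IsClosed (top z L) := fun z L hL =>
    hL.inter (isClosed_le continuous_const f.continuous)
  have hbot : ∀ z L, IsClosed L → IsClosed (bot z L) := fun z L hL =>
    hL.inter (isClosed_le f.continuous continuous_const)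
  let stuck : Set K → Set K → Prop := fun N N' =>
    N.Nonempty → (N' ∩ (𝒞 l).upper ((𝒞 l).type N)).Nonempty
  let B : Type _ := {L : Set K // IsClosed L ∧ ¬ ∃ p : Program, p.Controls 𝒞 f e L}
  have step : ∀ L : B, ∃ L' : B, L'.1 ⊆ L.1 ∧ ∃ z ∈ Set.Icc (-M) M,
      ¬ (stuck (top z L.1) (top z L'.1) ∧ stuck (bot z L.1) (bot z L'.1)) := by
    rintro ⟨L, hL, hLbad⟩
    obtain ⟨x, hx, y, hy, hxy⟩ : ∃ x ∈ L, ∃ y ∈ L, e / 2 < f x - f y := by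
      by_contra! H
      exact hLbad ⟨leaf, controls_leaf 𝒞 he H⟩
    have hrange : ∀ x, -(M - 1 : ℝ) ≤ f x / h ∧ f x / h ≤ M - 1 := by
      intro x
      have h1 : ‖f‖ / h ≤ M - 1 := by
        rw [hM]; push_cast
        linarith [Int.le_ceil (‖f‖ / h)]
      have h2 := div_le_div_of_nonneg_right (f.apply_le_norm x) hpos.le
      have h3 := div_le_div_of_nonneg_right (f.neg_norm_le_apply x) hpos.le
      rw [neg_div] at h3
      constructor <;> linarith
    set z : ℤ := ⌊f x / h⌋ with hz
    set w : ℤ := ⌈f y / h⌉ with hw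
    have hz1 : z * h ≤ f x := by
      rw [← le_div_iff₀ hpos]; exact Int.floor_le _
    have hz2 : f x < z * h + h := by
      have := Int.lt_floor_add_one (f x / h)
      rw [div_lt_iff₀ hpos] at this
      linarith
    have hw1 : f y ≤ w * h := by
      rw [← div_le_iff₀ hpos]; exact Int.le_ceil _
    have hw2 : w * h < f y + h := by
      have := Int.ceil_lt_add_one (f y / h)
      rw [← sub_lt_iff_lt_add, lt_div_iff₀ hpos] at this
      linarith
    have hzM : z ∈ Set.Icc (-M) M := by
      constructor
      · refine Int.le_floor.2 ?_
        push_cast; linarith [(hrange x).1]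
      · have : (z : ℝ) ≤ M := by linarith [(hrange x).2, Int.floor_le (f x / h)]
        exact_mod_cast this
    have hwM : w ∈ Set.Icc (-M) M := by
      constructor
      · have : (-M : ℝ) ≤ w := by linarith [(hrange y).1, Int.le_ceil (f y / h)]
        exact_mod_cast this
      · refine Int.ceil_le.2 ?_
        linarith [(hrange y).2]
    have neTop : (top z L).Nonempty := ⟨x, hx, hz1⟩
    have neBot : (bot w L).Nonempty := ⟨y, hy, hw1⟩
    -- Rounding costs less than `h` at each end, so the levels remain more than `4 * h - 2 * h = 2 *
    -- h` apart.
    obtain ⟨V, hVo, hVb, hVa, hV⟩ := exists_split 𝒞 (a := z * h) (b := w * h) (ε := h)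
      (by rw [hh] at hz2 hw2 ⊢; linarith) hpos.le hosc hL
      ((𝒞 l).detects_type (htop z L hL) neTop) ((𝒞 l).detects_type (hbot w L hL) neBot) e
    by_cases h1 : ∃ p : Program, p.Controls 𝒞 f e (L ∩ closure V)
    · by_cases h2 : ∃ q : Program, q.Controls 𝒞 f e (L \ V)
      · obtain ⟨p, hp⟩ := h1
        obtain ⟨q, hq⟩ := h2
        exact absurd (hV p q hp hq) hLbad
      · exact ⟨⟨L \ V, hL.sdiff hVo, h2⟩, Set.sdiff_subset, z, hzM, fun H => hVa (H.1 neTop)⟩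
    · exact ⟨⟨L ∩ closure V, hL.inter isClosed_closure, h1⟩, Set.inter_subset_left, w, hwM,
        fun H => hVb (H.2 neBot)⟩
  choose next hsub hnext using step
  let S : ℕ → B := fun n => Nat.rec ⟨Set.univ, isClosed_univ, hbad⟩ (fun _ L => next L) n
  have hanti : Antitone fun n => (S n).1 := antitone_nat_of_succ_le fun n => hsub (S n)
  have hev : ∀ᶠ i in atTop, ∀ z ∈ Set.Icc (-M) M,
      stuck (top z (S i).1) (top z (S (i + 1)).1) ∧ stuck (bot z (S i).1) (bot z (S (i + 1)).1) := by
    refine (Set.finite_Icc (-M) M).eventually_all.2 fun z _ => ?_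
    exact ((𝒞 l).eventually_inter_upper_type_nonempty (N := fun i => top z (S i).1)
      (fun i => htop z _ (S i).2.1)
      (fun i j hij => Set.inter_subset_inter_left _ (hanti hij))).and
      ((𝒞 l).eventually_inter_upper_type_nonempty (N := fun i => bot z (S i).1)
      (fun i => hbot z _ (S i).2.1)
      (fun i j hij => Set.inter_subset_inter_left _ (hanti hij)))
  obtain ⟨i, hi⟩ := hev.exists
  obtain ⟨z, hz, hz'⟩ := hnext (S i)
  exact hz' (hi z hz)

end Gauges

/-! ### The equivalent norm. -/

theorem theoremC {K : Type*} [TopologicalSpace K] [CompactSpace K] [T2Space K]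
    (d : K → K → ℝ) (hP : PropertyP K d) :
    ∃ N : Seminorm ℝ C(K, ℝ), IsEquivalentNorm N ∧
      ∀ f : C(K, ℝ), MetricUniformContinuous d f → IsLURAt N f := by
  have hex : ∀ l : ℕ, ∃ 𝒞 : IsolatedCover K, ∀ n x, ∀ y ∈ 𝒞.piece n x, ∀ z ∈ 𝒞.piece n x,
      d y z < 1 / ((l : ℝ) + 1) := fun l => hP.exists_isolatedCover (by positivity)
  choose 𝒞 h𝒞 using hex
  let w : Program → ℝ := fun p => 1 / 2 * (1 / 2) ^ Encodable.encode p
  have hw : ∀ p, 0 < w p := fun p => by positivity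
  have hws : Summable w := summable_geometric_two_encode.mul_left _
  have hw1 : ∑' p, w p ≤ 1 := by
    rw [tsum_mul_left]
    have h1 := tsum_comp_le_tsum_of_inj summable_geometric_two (fun _ => by positivity)
      (Encodable.encode_injective (α := Program))
    rw [tsum_geometric_two] at h1
    have h2 : ∑' p : Program, (1 / 2 : ℝ) ^ Encodable.encode p ≤ 2 := h1
    linarith
  let T : C(K, ℝ) → ℝ := fun g => ∑' p, w p * p.gauge 𝒞 Set.univ g
  have hgauge := fun p : Program => p.isSquareGauge_gauge 𝒞 Set.univ
  have hT : IsSquareGauge T := IsSquareGauge.tsum hgauge (fun p => (hw p).le) hws hw1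
  -- `T` is only positively homogeneous, so it is added to its reflection. The sum is at most `3 *
  -- ‖g‖ ^ 2`, so `C = 2` suffices.
  obtain ⟨N, hN, hNQ⟩ := ConvexOn.exists_seminorm_sq_eq
    (Q := fun g => ‖g‖ ^ 2 + (T g + T (-g))) (C := 2)
    (IsGauge.norm.sq.convexOn.add (hT.convexOn.add hT.comp_neg.convexOn))
    (fun c g => by
      rcases le_total 0 c with hc | hc
      · rw [← smul_neg, hT.smul c hc, hT.smul c hc, norm_smul, Real.norm_of_nonneg hc]
        ring
      · have e1 : c • g = (-c) • (-g) := by simp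
        have e2 : -(c • g) = (-c) • g := by simp
        rw [e2, e1, hT.smul (-c) (by linarith), hT.smul (-c) (by linarith), norm_smul,
          Real.norm_of_nonneg (by linarith : 0 ≤ -c), norm_neg]
        ring)
    (fun g => by linarith [hT.nonneg g, hT.nonneg (-g)])
    (fun g => by
      have h1 := hT.le g
      have h2 := hT.le (-g)
      rw [norm_neg] at h2
      nlinarith [sq_nonneg ‖g‖]) two_pos
  refine ⟨N, hN, fun f hf u hu => ?_⟩
  obtain ⟨c, C, hc, hC, hcC⟩ := hN
  -- The defect of `N ^ 2` is a sum of three nonnegative defects, one of which is that of `T`.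
  have hdef : Tendsto (fun r => defect T f (u r)) atTop (𝓝 0) := by
    refine squeeze_zero (fun r => hT.convexOn.defect_nonneg f (u r)) (fun r => ?_) hu
    simp only [hNQ]
    have h1 := (IsGauge.norm (E := C(K, ℝ))).sq.convexOn.defect_nonneg f (u r)
    have h2 := hT.comp_neg.convexOn.defect_nonneg f (u r)
    unfold defect at h1 h2 ⊢
    linarith
  have hnorm : Tendsto (fun r => ‖f - u r‖) atTop (𝓝 0) := by
    rw [Metric.tendsto_atTop]
    intro e he
    obtain ⟨δ, hδ, hfδ⟩ := hf (e / 2 / 8) (by positivity)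
    obtain ⟨l, hl⟩ := exists_nat_one_div_lt hδ
    -- Uniform continuity bounds the oscillation of `f` on the `d`-small pieces, and continuity
    -- extends the bound to their closures. Using `e / 2` leaves room for the strict inequality.
    obtain ⟨p, η, hη, hpη⟩ := Program.exists_controls_univ 𝒞 (f := f) (l := l)
      (half_pos he) fun n x y hy z hz => by
        have hcl : IsClosed {v : K × K | f v.1 - f v.2 ≤ e / 2 / 8} :=
          isClosed_le (by fun_prop) continuous_const
        have hsub : (𝒞 l).piece n x ×ˢ (𝒞 l).piece n x ⊆
            {v : K × K | f v.1 - f v.2 ≤ e / 2 / 8} := fun v hv =>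
          ((le_abs_self _).trans_lt (hfδ _ _ ((h𝒞 l n x _ hv.1 _ hv.2).trans hl))).le
        have hmem : (y, z) ∈ closure ((𝒞 l).piece n x ×ˢ (𝒞 l).piece n x) := by
          rw [closure_prod_eq]; exact ⟨hy, hz⟩
        exact closure_minimal hsub hcl hmem
    obtain ⟨θ, hθ, H⟩ := IsSquareGauge.dominates_tsum hgauge hw hws f p η hη
    obtain ⟨r₀, hr₀⟩ := (hdef.eventually_lt_const hθ).exists_forall_of_atTop
    refine ⟨r₀, fun r hr => ?_⟩
    have h1 : ‖f - u r‖ ≤ e / 2 := by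
      rw [ContinuousMap.norm_le _ (by positivity)]
      intro x
      exact hpη (u r) (H _ (hr₀ r hr)) x trivial
    rw [Real.dist_0_eq_abs, abs_of_nonneg (norm_nonneg _)]
    linarith
  refine squeeze_zero (fun r => apply_nonneg N _) (fun r => (hcC _).2) ?_
  simpa using hnorm.const_mul C
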